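/- All graphs are finite and simple, and $|H|$ is the number of vertices of $H$. A graph is $H$-free if it has no induced subgraph isomorphic to $H$. The degeneracy $\partial(G)$ is the smallest integer $d\ge 0$ such that every nonnull subgraph of $G$ has a vertex of degree at most $d$, and $\tau(G)$ is the largest $t\ge 0$ such that $K_{t,t}$ is a (not necessarily induced) subgraph of $G$. The height of a rooted tree $(H,r)$ is the number of edges of a longest path of $H$ with one end $r$. A vertex $v$ is a child of $u$ if $u,v$ are adjacent and $u$ lies on the path of $H$ between $v$ and $r$; the spread of $(H,r)$ is the maximum number of children of a vertex. (a) For every forest $H$ there is an integer $c>0$ such that every $H$-free graph $G$ satisfies $\partial(G)\le \tau(G)^c$ if $\tau(G)\ne 1$, and $\partial(G)\le c$ if $\tau(G)=1$. (b) Let $\eta,t\ge 1$ and $\zeta\ge 2$ be integers, and let $(H,r)$ be a rooted tree with height at most $\eta$ and spread at most $\zeta$. Then $$\partial(G)\le (|H|\,\zeta\, t)^{(\eta+3)!\,|H|}$$ for every $H$-free graph $G$ that does not contain $K_{t,t}$ as a (not necessarily induced) subgraph. -/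

import Mathlib

universe u v

namespace SimpleGraph

variable {V : Type u}

/-- `τ(G)`: the largest `t` such that `G` contains `K_{t,t}` as a (not necessarily induced)
subgraph. For a finite graph the maximum exists, see `isGreatest_bicliqueNumber`. -/
noncomputable def bicliqueNumber (G : SimpleGraph V) : ℕ :=
  sSup {t : ℕ | (completeBipartiteGraph (Fin t) (Fin t)).IsContained G}

theorem isGreatest_bicliqueNumber [Finite V] (G : SimpleGraph V) :
    IsGreatest {t : ℕ | (completeBipartiteGraph (Fin t) (Fin t)).IsContained G}
      G.bicliqueNumber := by
  have hne : {t : ℕ | (completeBipartiteGraph (Fin t) (Fin t)).IsContained G}.Nonempty :=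
    ⟨0, IsContained.of_isEmpty⟩
  have hbdd : BddAbove {t : ℕ | (completeBipartiteGraph (Fin t) (Fin t)).IsContained G} := by
    refine ⟨Nat.card V, ?_⟩
    rintro t ⟨f⟩
    have h := Nat.card_le_card_of_injective f f.injective
    simp only [Nat.card_sum, Nat.card_fin] at h
    omega
  exact ⟨Nat.sSup_mem hne hbdd, fun t ht => le_csSup hbdd ht⟩

/-- A (finite) graph `G` is `d`-degenerate if every nonnull subgraph of `G` has a vertex whose
degree in that subgraph is at most `d`. -/
def IsDegenerate (G : SimpleGraph V) (d : ℕ) : Prop :=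
  ∀ S : G.Subgraph, S.verts.Nonempty → ∃ x ∈ S.verts, (S.neighborSet x).ncard ≤ d

/-- `∂(G)`: the smallest `d` such that `G` is `d`-degenerate. For a finite graph the minimum
exists, see `isLeast_degeneracy`. -/
noncomputable def degeneracy (G : SimpleGraph V) : ℕ :=
  sInf {d : ℕ | G.IsDegenerate d}

theorem isLeast_degeneracy [Finite V] (G : SimpleGraph V) :
    IsLeast {d : ℕ | G.IsDegenerate d} G.degeneracy := by
  have hne : {d : ℕ | G.IsDegenerate d}.Nonempty :=
    ⟨Nat.card V, fun S ⟨x, hx⟩ => ⟨x, hx, Set.ncard_le_card _⟩⟩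
  exact ⟨Nat.sInf_mem hne, fun d hd => Nat.sInf_le hd⟩

/-- The height of the rooted tree `(H, r)`: the length (number of edges) of a longest path of `H`
with one end `r`. -/
noncomputable def rootedHeight (H : SimpleGraph V) (r : V) : ℕ :=
  sSup {n : ℕ | ∃ (x : V) (p : H.Walk r x), p.IsPath ∧ p.length = n}

theorem isGreatest_rootedHeight [Finite V] (H : SimpleGraph V) (r : V) :
    IsGreatest {n : ℕ | ∃ (x : V) (p : H.Walk r x), p.IsPath ∧ p.length = n}
      (H.rootedHeight r) := by
  have hne : {n : ℕ | ∃ (x : V) (p : H.Walk r x), p.IsPath ∧ p.length = n}.Nonempty :=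
    ⟨0, r, Walk.nil, Walk.IsPath.nil, rfl⟩
  have hbdd : BddAbove {n : ℕ | ∃ (x : V) (p : H.Walk r x), p.IsPath ∧ p.length = n} := by
    have := Fintype.ofFinite V
    refine ⟨Fintype.card V, ?_⟩
    rintro n ⟨x, p, hp, rfl⟩
    exact hp.length_lt.le
  exact ⟨Nat.sSup_mem hne hbdd, fun t ht => le_csSup hbdd ht⟩

/-- In the rooted tree `(H, r)`, the vertex `x` is a child of `w`: the two are adjacent and `w`
lies on the path of `H` between `x` and `r` (this path is unique, `H` being a tree). -/
def IsChild (H : SimpleGraph V) (r w x : V) : Prop :=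
  H.Adj w x ∧ ∃ p : H.Walk x r, p.IsPath ∧ w ∈ p.support

/-- The spread of the rooted tree `(H, r)`: the maximum over all vertices `w` of the number of
children of `w`. -/
noncomputable def spread (H : SimpleGraph V) (r : V) : ℕ :=
  ⨆ w : V, {x : V | H.IsChild r w x}.ncard

theorem isGreatest_spread [Finite V] (H : SimpleGraph V) (r : V) :
    IsGreatest (Set.range fun w : V => {x : V | H.IsChild r w x}.ncard) (H.spread r) := by
  have hbdd := (Set.finite_range fun w : V => {x : V | H.IsChild r w x}.ncard).bddAbove
  exact ⟨Nat.sSup_mem ⟨_, r, rfl⟩ hbdd, fun t ht => le_csSup hbdd ht⟩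

end SimpleGraph

/-! A `K_{t,t}`-free graph of large minimum degree contains every forest as an induced subgraph;
applied to the subgraph witnessing large degeneracy, this gives both bounds.

The tool is a branching tree all of whose root paths are induced. It is robust: by
`card_not_branches_le`, at most `(5t)^h` vertices have a closed neighbourhood whose removal ruins a
tree of height `h`, if the required branching may drop by a factor `4t`. By
`mul_sum_degree_not_branches_le`, roots without such a tree carry at most a `(5t)^h / d` share of
the total degree, so some root has one.

`exists_partial_embedding` then embeds the forest vertex by vertex. Every image keeps a tree
avoiding the closed neighbourhoods of the other images, and a new vertex, having at most one earlier
neighbour, is placed at a child in that neighbour's tree. Robustness leaves a child that spoils none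
of the trees. Each step costs one level of height and a factor `4t` of branching. -/

namespace SimpleGraph

/-! ### Branching trees: robustness and existence -/

section Branching

variable {W : Type*} (G : SimpleGraph W)

/-- The closed neighbourhood of a vertex. -/
def closedNbhd (x : W) : Set W := {y | y = x ∨ G.Adj x y}

variable {G} in
theorem mem_closedNbhd {x y : W} : y ∈ G.closedNbhd x ↔ y = x ∨ G.Adj x y := Iff.rfl

variable {G} in
theorem isContained_completeBipartiteGraph_of_forall_adj {t : ℕ} {A B : Finset W}
    (hA : t ≤ A.card) (hB : t ≤ B.card) (h : ∀ a ∈ A, ∀ b ∈ B, G.Adj a b) :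
    (completeBipartiteGraph (Fin t) (Fin t)).IsContained G := by
  obtain ⟨f⟩ : Nonempty (Fin t ↪ A) :=
    Function.Embedding.nonempty_of_card_le (by simpa using hA)
  obtain ⟨g⟩ : Nonempty (Fin t ↪ B) :=
    Function.Embedding.nonempty_of_card_le (by simpa using hB)
  have hfg : ∀ i j, G.Adj (f i) (g j) := fun i j => h _ (f i).2 _ (g j).2
  refine ⟨⟨⟨Sum.elim (fun i => (f i : W)) (fun i => (g i : W)), ?_⟩, ?_⟩⟩
  · rintro (i | i) (j | j) hij
    · simp at hij
    · exact hfg i j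
    · exact (hfg j i).symm
    · simp at hij
  · rintro (i | i) (j | j) hij
    · simpa [Subtype.coe_inj] using hij
    · exact absurd hij (hfg i j).ne
    · exact absurd hij (hfg j i).ne'
    · simpa [Subtype.coe_inj] using hij

open Classical in
/-- `G.Branches M h X v`: there is a tree of height `h` rooted at `v`, avoiding `X` outside its
root, in which every vertex that is not at depth `h` has at least `M` children and every path
starting at the root is induced. -/
def Branches [Fintype W] (M : ℕ) : ℕ → Set W → W → Prop
  | 0, _, _ => True
  | h + 1, X, v =>
    M ≤ (Finset.univ.filter fun y =>
      G.Adj v y ∧ y ∉ X ∧ Branches M h (X ∪ G.closedNbhd v) y).card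

variable {G} [Fintype W]

theorem Branches.mono {M M' : ℕ} (hM : M' ≤ M) {h : ℕ} {X X' : Set W} {v : W} (hX : X' ⊆ X)
    (hv : G.Branches M h X v) : G.Branches M' h X' v := by
  induction h generalizing X X' v with
  | zero => trivial
  | succ h ih =>
    refine (hM.trans hv).trans (Finset.card_le_card fun y hy => ?_)
    simp only [Finset.mem_filter, Finset.mem_univ, true_and] at hy ⊢
    exact ⟨hy.1, fun hn => hy.2.1 (hX hn), ih (Set.union_subset_union_left _ hX) hy.2.2⟩

theorem Branches.of_succ {M h : ℕ} {X : Set W} {v : W}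
    (hv : G.Branches M (h + 1) X v) : G.Branches M h X v := by
  induction h generalizing X v with
  | zero => trivial
  | succ h ih =>
    refine le_trans hv (Finset.card_le_card fun y hy => ?_)
    simp only [Finset.mem_filter, Finset.mem_univ, true_and] at hy ⊢
    exact ⟨hy.1, hy.2.1, ih hy.2.2⟩

open Classical in
/-- In a graph without `K_{t,t}`, fewer than `t` vertices have few non-neighbours in a large
set. -/
theorem card_lt_of_forall_card_sdiff_closedNbhd {t : ℕ}
    (hG : (completeBipartiteGraph (Fin t) (Fin t)).Free G) {B C : Finset W}
    (hC : 4 * t ≤ C.card)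
    (hB : ∀ x ∈ B, 2 * t * (C.filter fun y => y ∉ G.closedNbhd x).card ≤ C.card) :
    B.card < t := by
  by_contra! hlt
  obtain ⟨A, hAB, hA⟩ := Finset.exists_subset_card_eq hlt
  refine hG (isContained_completeBipartiteGraph_of_forall_adj
    (A := A) (B := C.filter fun y => ∀ x ∈ A, G.Adj x y) hA.ge ?_
    fun a ha b hb => (Finset.mem_filter.1 hb).2 a ha)
  -- The non-neighbours cost at most `|C|/2` and `A` itself at most `t`, so `|C|/2 - t ≥ t` common
  -- neighbours remain.
  have hcover : C ⊆ (C.filter fun y => ∀ x ∈ A, G.Adj x y) ∪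
      (A ∪ A.biUnion fun x => C.filter fun y => y ∉ G.closedNbhd x) := by
    intro y hy
    by_cases hyA : ∀ x ∈ A, G.Adj x y
    · simp only [Finset.mem_union, Finset.mem_filter]
      exact Or.inl ⟨hy, hyA⟩
    · push Not at hyA
      obtain ⟨x, hx, hxy⟩ := hyA
      simp only [Finset.mem_union, Finset.mem_biUnion, Finset.mem_filter]
      by_cases hyx : y = x
      · exact Or.inr (Or.inl (hyx ▸ hx))
      · exact Or.inr (Or.inr ⟨x, hx, hy, by simp [mem_closedNbhd, hyx, hxy]⟩)
  have h1 := Finset.card_le_card hcover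
  have h2 := Finset.card_union_le (C.filter fun y => ∀ x ∈ A, G.Adj x y)
      (A ∪ A.biUnion fun x => C.filter fun y => y ∉ G.closedNbhd x)
  have h3 := Finset.card_union_le A (A.biUnion fun x => C.filter fun y => y ∉ G.closedNbhd x)
  have h4 : (A.biUnion fun x => C.filter fun y => y ∉ G.closedNbhd x).card ≤
      ∑ x ∈ A, (C.filter fun y => y ∉ G.closedNbhd x).card := Finset.card_biUnion_le
  have h5 : 2 * t * ∑ x ∈ A, (C.filter fun y => y ∉ G.closedNbhd x).card ≤ t * C.card := by
    rw [Finset.mul_sum, ← hA, ← smul_eq_mul A.card]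
    exact Finset.sum_le_card_nsmul _ _ _ fun x hx => by simpa [hA] using hB x (hAB hx)
  rcases Nat.eq_zero_or_pos t with rfl | ht
  · simp
  have h6 : 2 * ∑ x ∈ A, (C.filter fun y => y ∉ G.closedNbhd x).card ≤ C.card :=
    Nat.le_of_mul_le_mul_left (by linarith) ht
  omega

open Classical in
/-- In a graph without `K_{t,t}`, the closed neighbourhoods of only few vertices can destroy a
given branching tree. -/
theorem card_not_branches_le {t : ℕ} (ht : 1 ≤ t)
    (hG : (completeBipartiteGraph (Fin t) (Fin t)).Free G) {M : ℕ} (hM : 1 ≤ M) {h : ℕ}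
    {X : Set W} {v : W} (hv : G.Branches (4 * t * M) h X v) :
    (Finset.univ.filter fun x => ¬ G.Branches M h (X ∪ G.closedNbhd x) v).card ≤
      (5 * t) ^ h := by
  induction h generalizing X v with
  | zero => simp [Branches]
  | succ h ih =>
    set C := Finset.univ.filter fun y =>
      G.Adj v y ∧ y ∉ X ∧ G.Branches (4 * t * M) h (X ∪ G.closedNbhd v) y with hCdef
    have hC : 4 * t * M ≤ C.card := hv
    have hC4 : 4 * t ≤ C.card := le_trans (Nat.le_mul_of_pos_right _ hM) hC
    set B := Finset.univ.filter fun x => ¬ G.Branches M (h + 1) (X ∪ G.closedNbhd x) v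
    -- Fewer than `t` destroyers `x` dominate almost all of `C`. Any other leaves over `|C|/(2t)`
    -- children uncovered, fewer than `M ≤ |C|/(4t)` of which survive, so it ruins the subtrees of
    -- at least `|C|/(4t)` children. Double counting with the induction hypothesis bounds these by
    -- `4t(5t)^h`.
    let few : W → Prop := fun x =>
      2 * t * (C.filter fun y => y ∉ G.closedNbhd x).card ≤ C.card
    let bad : W → W → Prop := fun x y =>
      ¬ G.Branches M h (X ∪ G.closedNbhd v ∪ G.closedNbhd x) y
    have h1 : (B.filter few).card < t :=
      card_lt_of_forall_card_sdiff_closedNbhd hG hC4 fun x hx => (Finset.mem_filter.1 hx).2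
    have h2 : ∀ x ∈ B.filter (fun x => ¬ few x),
        C.card ≤ 4 * t * (C.bipartiteAbove bad x).card := by
      intro x hx
      obtain ⟨hxB, hxf⟩ := Finset.mem_filter.1 hx
      have hlt : (C.filter fun y => y ∉ G.closedNbhd x ∧ ¬ bad x y).card < M := by
        have := (Finset.mem_filter.1 hxB).2
        rw [Branches, not_le] at this
        refine lt_of_le_of_lt (Finset.card_le_card fun y hy => ?_) this
        simp only [hCdef, bad, Finset.mem_filter, Finset.mem_univ, true_and, not_not,
          Set.mem_union] at hy ⊢
        refine ⟨hy.1.1, by tauto, ?_⟩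
        rw [Set.union_right_comm]
        exact hy.2.2
      have hsub : (C.filter fun y => y ∉ G.closedNbhd x) ⊆
          (C.filter fun y => y ∉ G.closedNbhd x ∧ ¬ bad x y) ∪ C.bipartiteAbove bad x := by
        intro y hy
        simp only [Finset.mem_union, Finset.mem_filter, Finset.mem_bipartiteAbove] at hy ⊢
        tauto
      have h3 := (Finset.card_le_card hsub).trans (Finset.card_union_le _ _)
      have h4 : C.card < 2 * t * (C.filter fun y => y ∉ G.closedNbhd x).card := not_le.1 hxf
      have h5 := Nat.mul_le_mul_left (4 * t) h3
      have h6 := Nat.mul_le_mul_left (4 * t) hlt.le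
      linarith
    have h3 : (B.filter fun x => ¬ few x).card * C.card ≤ 4 * t * (C.card * (5 * t) ^ h) := by
      calc (B.filter fun x => ¬ few x).card * C.card
          ≤ ∑ x ∈ B.filter (fun x => ¬ few x), 4 * t * (C.bipartiteAbove bad x).card :=
            Finset.card_nsmul_le_sum _ _ _ h2
        _ = 4 * t * ∑ y ∈ C,
              ((B.filter fun x => ¬ few x).bipartiteBelow bad y).card := by
            rw [← Finset.mul_sum, Finset.sum_card_bipartiteAbove_eq_sum_card_bipartiteBelow]
        _ ≤ 4 * t * (C.card * (5 * t) ^ h) := by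
            refine Nat.mul_le_mul_left _ (Finset.sum_le_card_nsmul _ _ _ fun y hy => ?_)
            refine le_trans (Finset.card_le_card fun x hx => ?_)
              (ih (Finset.mem_filter.1 hy).2.2.2)
            simpa using ((Finset.mem_bipartiteBelow _).1 hx).2
    have h4 : (B.filter fun x => ¬ few x).card ≤ 4 * t * (5 * t) ^ h :=
      Nat.le_of_mul_le_mul_right (by linarith) (show 0 < C.card by omega)
    have h5 := Finset.card_filter_add_card_filter_not (s := B) few
    have h6 : 1 ≤ (5 * t) ^ h := Nat.one_le_pow _ _ (by omega)
    have h7 := Nat.mul_le_mul_left t h6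
    rw [pow_succ]
    linarith

-- A root that fails at height `h + 1` has at least half of its neighbours failing once its closed
-- neighbourhood is forbidden. Weighting by degree lets a vertex that fails outright be charged by
-- all its neighbours, since degrees have no upper bound.
open Classical in
theorem mul_sum_degree_not_branches_le {t : ℕ} (ht : 1 ≤ t)
    (hG : (completeBipartiteGraph (Fin t) (Fin t)).Free G) {d : ℕ}
    (hd : ∀ v, d ≤ (Finset.univ.filter fun y => G.Adj v y).card) (h : ℕ) {M : ℕ} (hM : 1 ≤ M)
    (hMd : 2 * ((4 * t) ^ h * M) ≤ d) :
    d * ∑ v with ¬ G.Branches M h ∅ v, (Finset.univ.filter fun y => G.Adj v y).card ≤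
      (5 * t) ^ h * ∑ v, (Finset.univ.filter fun y => G.Adj v y).card := by
  induction h generalizing M with
  | zero => simp [Branches]
  | succ h ih =>
    let deg : W → ℕ := fun v => (Finset.univ.filter fun y => G.Adj v y).card
    let r : W → W → Prop := fun v y => G.Adj v y ∧ ¬ G.Branches M h (∅ ∪ G.closedNbhd v) y
    have hMd' : 2 * ((4 * t) ^ h * (4 * t * M)) ≤ d := by
      rwa [pow_succ, mul_assoc ((4 * t) ^ h)] at hMd
    have hM2 : 2 * M ≤ d := by
      refine le_trans (Nat.mul_le_mul_left 2 (Nat.le_mul_of_pos_left _ ?_)) hMd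
      positivity
    have hIH := ih (M := 4 * t * M) (Nat.mul_pos (by omega) hM) hMd'
    have h1 : ∀ v, ¬ G.Branches M (h + 1) ∅ v →
        deg v ≤ 2 * (Finset.univ.bipartiteAbove r v).card := by
      intro v hv
      rw [Branches, not_le] at hv
      have hlt : (Finset.univ.filter fun y =>
          G.Adj v y ∧ G.Branches M h (∅ ∪ G.closedNbhd v) y).card < M :=
        lt_of_le_of_lt (Finset.card_le_card fun y hy => by simpa using hy) hv
      have hsub : (Finset.univ.filter fun y => G.Adj v y) ⊆ (Finset.univ.filter fun y =>
          G.Adj v y ∧ G.Branches M h (∅ ∪ G.closedNbhd v) y) ∪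
          Finset.univ.bipartiteAbove r v := by
        intro y hy
        simp only [Finset.mem_union, Finset.mem_filter, Finset.mem_bipartiteAbove,
          Finset.mem_univ, true_and, r] at hy ⊢
        tauto
      have h3 : deg v ≤ _ := (Finset.card_le_card hsub).trans (Finset.card_union_le _ _)
      have h4 : d ≤ deg v := hd v
      omega
    -- Either `y` fails with nothing forbidden, or robustness limits the `v` that spoil its tree.
    have h2 : ∀ y, (Finset.univ.bipartiteBelow r y).card ≤
        (if ¬ G.Branches (4 * t * M) h ∅ y then deg y else 0) + (5 * t) ^ h := by
      intro y
      split_ifs with hy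
      · rw [zero_add]
        refine le_trans (Finset.card_le_card fun v hv => ?_)
          (card_not_branches_le ht hG hM hy)
        simpa using ((Finset.mem_bipartiteBelow _).1 hv).2.2
      · refine le_trans (Finset.card_le_card fun v hv => ?_) (Nat.le_add_right _ _)
        simpa using ((Finset.mem_bipartiteBelow _).1 hv).2.1.symm
    have h3 : ∑ v with ¬ G.Branches M (h + 1) ∅ v, deg v ≤
        2 * (∑ y with ¬ G.Branches (4 * t * M) h ∅ y, deg y +
          Fintype.card W * (5 * t) ^ h) := by
      calc ∑ v with ¬ G.Branches M (h + 1) ∅ v, deg v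
          ≤ ∑ v with ¬ G.Branches M (h + 1) ∅ v,
              2 * (Finset.univ.bipartiteAbove r v).card :=
            Finset.sum_le_sum fun v hv => h1 v (Finset.mem_filter.1 hv).2
        _ ≤ ∑ v, 2 * (Finset.univ.bipartiteAbove r v).card :=
            Finset.sum_le_sum_of_subset (Finset.filter_subset _ _)
        _ = 2 * ∑ y, (Finset.univ.bipartiteBelow r y).card := by
            rw [← Finset.mul_sum, Finset.sum_card_bipartiteAbove_eq_sum_card_bipartiteBelow]
        _ ≤ 2 * ∑ y, ((if ¬ G.Branches (4 * t * M) h ∅ y then deg y else 0) + (5 * t) ^ h) :=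
            Nat.mul_le_mul_left _ (Finset.sum_le_sum fun y _ => h2 y)
        _ = _ := by
            rw [Finset.sum_add_distrib, Finset.sum_filter, Finset.sum_const, smul_eq_mul,
              Finset.card_univ]
    have h4 : Fintype.card W * d ≤ ∑ v, deg v := by
      simpa using Finset.card_nsmul_le_sum Finset.univ deg d fun v _ => hd v
    have h5 := Nat.mul_le_mul_left d h3
    have h6 := Nat.mul_le_mul_left ((5 * t) ^ h) h4
    have h7 : (5 * t) ^ (h + 1) * ∑ v, deg v =
        5 * (t * ((5 * t) ^ h * ∑ v, deg v)) := by ring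
    have h8 : (5 * t) ^ h * ∑ v, deg v ≤ t * ((5 * t) ^ h * ∑ v, deg v) :=
      Nat.le_mul_of_pos_left _ ht
    change d * ∑ v with ¬ G.Branches M (h + 1) ∅ v, deg v ≤ (5 * t) ^ (h + 1) * ∑ v, deg v
    change d * ∑ v with ¬ G.Branches (4 * t * M) h ∅ v, deg v ≤ (5 * t) ^ h * ∑ v, deg v at hIH
    have h9 := Nat.zero_le (t * ((5 * t) ^ h * ∑ v, deg v))
    rw [h7]
    linarith

open Classical in
theorem exists_branches [Nonempty W] {t : ℕ} (ht : 1 ≤ t)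
    (hG : (completeBipartiteGraph (Fin t) (Fin t)).Free G) {d : ℕ}
    (hd : ∀ v, d ≤ (Finset.univ.filter fun y => G.Adj v y).card) {h M : ℕ} (hM : 1 ≤ M)
    (hMd : 2 * ((4 * t) ^ h * M) ≤ d) (hd' : (5 * t) ^ h < d) :
    ∃ v, G.Branches M h ∅ v := by
  by_contra! hno
  have h1 := mul_sum_degree_not_branches_le ht hG hd h hM hMd
  rw [Finset.filter_true_of_mem fun v _ => hno v] at h1
  have h2 : Fintype.card W * d ≤ ∑ v, (Finset.univ.filter fun y => G.Adj v y).card := by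
    simpa using Finset.card_nsmul_le_sum Finset.univ
      (fun v => (Finset.univ.filter fun y => G.Adj v y).card) d fun v _ => hd v
  have h3 : 0 < ∑ v, (Finset.univ.filter fun y => G.Adj v y).card :=
    lt_of_lt_of_le (Nat.mul_pos Fintype.card_pos (by omega)) h2
  exact absurd (Nat.le_of_mul_le_mul_right h1 h3) (by omega)

end Branching

/-! ### Greedy induced embedding of a forest -/

section Embedding

variable {V W : Type*} {H : SimpleGraph V} {G : SimpleGraph W}

-- The end of a longest path works: a further neighbour would extend the path or close a cycle.
open Classical in
theorem IsAcyclic.exists_mem_card_adj_le_one (hH : H.IsAcyclic) {T : Finset V}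
    (hT : T.Nonempty) : ∃ v ∈ T, (T.filter fun u => H.Adj v u).card ≤ 1 := by
  have hF := hH.induce (T : Set V)
  have : Nonempty (T : Set V) := hT.to_subtype
  obtain ⟨u, v, p, hp, hmax⟩ :=
    Walk.exists_isPath_forall_isPath_length_le_length (H.induce (T : Set V))
  refine ⟨v, v.2, Finset.card_le_one.2 ?_⟩
  have key : ∀ a ∈ T.filter (fun u => H.Adj v u), a = (p.penultimate : V) := by
    intro a ha
    obtain ⟨haT, hva⟩ := Finset.mem_filter.1 ha
    have hadj : (H.induce (T : Set V)).Adj v ⟨a, haT⟩ := hva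
    by_cases hs : (⟨a, haT⟩ : (T : Set V)) ∈ p.support
    · exact congrArg Subtype.val (hF.eq_penultimate_of_adj_end hp hadj hs)
    · have := hmax _ _ _ (hp.concat hs hadj)
      rw [Walk.length_concat] at this
      omega
  intro a ha b hb
  rw [key a ha, key b hb]

-- The index `none` is a reserve root, outside the embedded forest, from which vertices without an
-- earlier neighbour are grown. The parameter `k` counts the steps still affordable.
open Classical in
theorem exists_partial_embedding [Fintype V] [Fintype W] [Nonempty W] (hH : H.IsAcyclic) {t : ℕ}
    (ht : 1 ≤ t) (hG : (completeBipartiteGraph (Fin t) (Fin t)).Free G) {n : ℕ}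
    (hroot : ∃ v, G.Branches ((n + 1) * (5 * t) ^ n * (4 * t) ^ n) n ∅ v) (T : Finset V)
    {k : ℕ} (hk : T.card + k = n) :
    ∃ φ : Option V → W,
      (∀ u ∈ T, ∀ v ∈ T, u ≠ v → φ (some u) ≠ φ (some v)) ∧
      (∀ u ∈ T, ∀ v ∈ T, H.Adj u v ↔ G.Adj (φ (some u)) (φ (some v))) ∧
      ∀ p ∈ T.insertNone, G.Branches ((n + 1) * (5 * t) ^ n * (4 * t) ^ k) k
        {w | ∃ q ∈ T.insertNone, q ≠ p ∧ w ∈ G.closedNbhd (φ q)} (φ p) := by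
  induction hj : T.card generalizing T k with
  | zero =>
    obtain ⟨v, hv⟩ := hroot
    obtain rfl : T = ∅ := Finset.card_eq_zero.1 hj
    obtain rfl : k = n := by simpa using hk
    refine ⟨fun _ => v, by simp, by simp, fun p hp => hv.mono le_rfl ?_⟩
    rintro w ⟨q, hq, hqp, -⟩
    cases p <;> cases q <;> simp_all
  | succ j ih =>
    have hT : T.Nonempty := Finset.card_pos.1 (by omega)
    obtain ⟨v, hvT, hv⟩ := hH.exists_mem_card_adj_le_one hT
    have hcard : (T.erase v).card = j := by rw [Finset.card_erase_of_mem hvT]; omega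
    obtain ⟨φ, hinj, hadj, hbr⟩ := ih (T.erase v) (k := k + 1) (by omega) hcard
    set S := (T.erase v).insertNone with hS
    have hmemS : ∀ u, some u ∈ S ↔ u ≠ v ∧ u ∈ T := by simp [hS]
    have hnoneS : none ∈ S := by simp [hS]
    have hScard : S.card = j + 1 := by rw [hS, Finset.card_insertNone, hcard]
    -- The attachment point `p` is the unique neighbour of `v` in `T`, or the reserve root.
    obtain ⟨p, hpS, hp⟩ : ∃ p ∈ S, ∀ u ∈ T, H.Adj v u ↔ some u = p := by
      rcases Finset.eq_empty_or_nonempty (T.filter fun u => H.Adj v u) with h0 | ⟨u, hu⟩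
      · refine ⟨none, hnoneS, fun u hu => ?_⟩
        simpa using Finset.filter_eq_empty_iff.1 h0 hu
      · obtain ⟨huT, hvu⟩ := Finset.mem_filter.1 hu
        refine ⟨some u, (hmemS u).2 ⟨hvu.ne', huT⟩, fun w hw => ⟨fun hvw => ?_, ?_⟩⟩
        · rw [Finset.card_le_one.1 hv w (Finset.mem_filter.2 ⟨hw, hvw⟩) u hu]
        · rintro ⟨⟩
          exact hvu
    set L := (n + 1) * (5 * t) ^ n
    let X : Option V → Set W := fun p => {w | ∃ q ∈ S, q ≠ p ∧ w ∈ G.closedNbhd (φ q)}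
    have hLk : L * (4 * t) ^ (k + 1) = 4 * t * (L * (4 * t) ^ k) := by ring
    have hLpos : 1 ≤ L * (4 * t) ^ k := Nat.mul_pos (by positivity) (by positivity)
    set C := Finset.univ.filter fun y => G.Adj (φ p) y ∧ y ∉ X p ∧
      G.Branches (L * (4 * t) ^ (k + 1)) k (X p ∪ G.closedNbhd (φ p)) y
    have hC : L * (4 * t) ^ (k + 1) ≤ C.card :=
      le_trans (hbr p hpS) (Finset.card_le_card fun y hy => by
        simp only [Finset.mem_filter] at hy
        exact Finset.mem_filter.2 hy)
    let D : Option V → Finset W := fun q => Finset.univ.filter fun x =>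
      ¬ G.Branches (L * (4 * t) ^ k) (k + 1) (X q ∪ G.closedNbhd x) (φ q)
    have hD : ∀ q ∈ S, (D q).card ≤ (5 * t) ^ (k + 1) := by
      intro q hq
      have := hbr q hq
      rw [hLk] at this
      exact card_not_branches_le ht hG hLpos this
    -- There are at most `n` trees to protect, the tree of `p` included; the factor `n + 1` in `L`
    -- makes the inequality strict.
    have hlt : (S.biUnion D).card < C.card := by
      refine lt_of_lt_of_le ?_ hC
      calc (S.biUnion D).card ≤ S.card * (5 * t) ^ (k + 1) :=
            Finset.card_biUnion_le_card_mul _ _ _ hD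
        _ ≤ n * (5 * t) ^ n := by
            refine Nat.mul_le_mul (by omega) (Nat.pow_le_pow_right (by omega) (by omega))
        _ < (n + 1) * (5 * t) ^ n :=
            Nat.mul_lt_mul_of_pos_right (Nat.lt_succ_self n) (by positivity)
        _ ≤ L * (4 * t) ^ (k + 1) := Nat.le_mul_of_pos_right _ (by positivity)
    obtain ⟨x, hxC, hxD⟩ := Finset.exists_mem_notMem_of_card_lt_card hlt
    obtain ⟨hpx, hxX, hxB⟩ := (Finset.mem_filter.1 hxC).2
    have hxgood : ∀ q ∈ S,
        G.Branches (L * (4 * t) ^ k) (k + 1) (X q ∪ G.closedNbhd x) (φ q) := by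
      intro q hq
      by_contra hn
      exact hxD (Finset.mem_biUnion.2 ⟨q, hq, Finset.mem_filter.2 ⟨Finset.mem_univ _, hn⟩⟩)
    have hxne : ∀ q ∈ S, φ q ≠ x := by
      rintro q hq rfl
      by_cases hqp : q = p
      · exact hpx.ne (by rw [hqp])
      · exact hxX ⟨q, hq, hqp, Or.inl rfl⟩
    have hxadj : ∀ q ∈ S, G.Adj (φ q) x ↔ q = p := by
      refine fun q hq => ⟨fun h => ?_, by rintro rfl; exact hpx⟩
      by_contra hqp
      exact hxX ⟨q, hq, hqp, Or.inr h⟩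
    have hxv : ∀ u ∈ T, u ≠ v → (H.Adj v u ↔ G.Adj x (φ (some u))) := fun u hu huv => by
      rw [hp u hu, G.adj_comm, hxadj _ ((hmemS u).2 ⟨huv, hu⟩)]
    let ψ : Option V → W := Function.update φ (some v) x
    have hψv : ψ (some v) = x := Function.update_self ..
    have hψ : ∀ q, q ≠ some v → ψ q = φ q := fun q hq => Function.update_of_ne hq ..
    have hψ' : ∀ u, u ≠ v → ψ (some u) = φ (some u) := fun u hu => hψ _ (by simpa using hu)
    have hTS : ∀ q ∈ T.insertNone, q ≠ some v → q ∈ S := by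
      rintro (_ | u) hq hqv
      · exact hnoneS
      · exact (hmemS u).2 ⟨by simpa using hqv, by simpa using hq⟩
    refine ⟨ψ, fun a ha b hb hab => ?_, fun a ha b hb => ?_, fun q hq => ?_⟩
    · by_cases hav : a = v
      · subst hav
        rw [hψv, hψ' b hab.symm]
        exact (hxne _ ((hmemS b).2 ⟨hab.symm, hb⟩)).symm
      · by_cases hbv : b = v
        · subst hbv
          rw [hψv, hψ' a hab]
          exact hxne _ ((hmemS a).2 ⟨hab, ha⟩)
        · rw [hψ' a hav, hψ' b hbv]
          exact hinj a (by simp [hav, ha]) b (by simp [hbv, hb]) hab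
    · by_cases hav : a = v
      · subst hav
        by_cases hba : b = a
        · subst hba
          simp
        · rw [hψv, hψ' b hba]
          exact hxv b hb hba
      · by_cases hbv : b = v
        · subst hbv
          rw [hψv, hψ' a hav, H.adj_comm, G.adj_comm]
          exact hxv a ha hav
        · rw [hψ' a hav, hψ' b hbv]
          exact hadj a (by simp [hav, ha]) b (by simp [hbv, hb])
    · by_cases hqv : q = some v
      · subst hqv
        rw [hψv]
        -- The subtree at `x` avoids `X p` and the closed neighbourhood of `φ p`, which together
        -- cover those of all other images.
        refine hxB.mono (by rw [hLk]; exact Nat.le_mul_of_pos_left _ (by omega)) ?_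
        rintro w ⟨q, hq, hqv, hw⟩
        rw [hψ q hqv] at hw
        by_cases hqp : q = p
        · exact Or.inr (hqp ▸ hw)
        · exact Or.inl ⟨q, hTS q hq hqv, hqp, hw⟩
      · rw [hψ q hqv]
        refine (hxgood q (hTS q hq hqv)).of_succ.mono le_rfl ?_
        rintro w ⟨q', hq', hqq', hw⟩
        by_cases hqv' : q' = some v
        · subst hqv'
          rw [hψv] at hw
          exact Or.inr hw
        · rw [hψ q' hqv'] at hw
          exact Or.inl ⟨q', hTS q' hq' hqv', hqq', hw⟩

open Classical in
/-- A graph without `K_{t,t}` with large minimum degree contains every forest as an induced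
subgraph. -/
theorem IsAcyclic.isIndContained_of_le_minDegree [Fintype V] [Fintype W] [Nonempty W]
    (hH : H.IsAcyclic) {t : ℕ} (ht : 1 ≤ t)
    (hG : (completeBipartiteGraph (Fin t) (Fin t)).Free G) {d : ℕ}
    (hd : ∀ v, d ≤ (Finset.univ.filter fun y => G.Adj v y).card)
    (hdn : 2 * ((4 * t) ^ Fintype.card V * ((Fintype.card V + 1) * (5 * t) ^ Fintype.card V *
      (4 * t) ^ Fintype.card V)) ≤ d) :
    H.IsIndContained G := by
  have h4 : 1 ≤ (4 * t) ^ Fintype.card V := Nat.one_le_pow _ _ (by omega)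
  have h5 : 1 ≤ (5 * t) ^ Fintype.card V := Nat.one_le_pow _ _ (by omega)
  have hroot := exists_branches ht hG hd (Nat.mul_pos (Nat.mul_pos (Nat.succ_pos _) h5) h4) hdn
    (by
      refine lt_of_lt_of_le ?_ hdn
      have h6 := Nat.mul_le_mul h4 (Nat.mul_le_mul
        (Nat.mul_le_mul (Nat.le_add_left 1 (Fintype.card V)) (le_refl ((5 * t) ^ Fintype.card V)))
        h4)
      omega)
  obtain ⟨φ, hinj, hadj, -⟩ := exists_partial_embedding hH ht hG hroot Finset.univ (k := 0)
    (by simp)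
  refine ⟨⟨⟨fun v => φ (some v), fun u v huv => ?_⟩, fun {u v} => ?_⟩⟩
  · by_contra hne
    exact hinj u (Finset.mem_univ _) v (Finset.mem_univ _) hne huv
  · exact (hadj u (Finset.mem_univ _) v (Finset.mem_univ _)).symm

/-! ### From minimum degree to degeneracy -/

theorem two_mul_pow_le_pow {n t b : ℕ} (hn : 1 ≤ n) (ht : 1 ≤ t) (hb : 2 * n * t ≤ b) :
    2 * ((4 * t) ^ n * ((n + 1) * (5 * t) ^ n * (4 * t) ^ n)) ≤ b ^ (24 * n) := by
  have h1 : 2 * n ≤ b := le_trans (Nat.le_mul_of_pos_right _ ht) hb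
  have h2 : 2 * t ≤ b := le_trans (by nlinarith) hb
  have h3 : 2 ≤ b := by omega
  have h4 : 4 * t ≤ b ^ 2 := by nlinarith
  have h5 : 5 * t ≤ b ^ 3 := by nlinarith
  have h6 : n + 1 ≤ b := by omega
  calc 2 * ((4 * t) ^ n * ((n + 1) * (5 * t) ^ n * (4 * t) ^ n))
      ≤ b * ((b ^ 2) ^ n * (b * (b ^ 3) ^ n * (b ^ 2) ^ n)) := by gcongr
    _ = b ^ (7 * n + 2) := by ring
    -- There is slack here; `24 = 4!` is compared with `(η + 3)!` in part (b).
    _ ≤ b ^ (24 * n) := Nat.pow_le_pow_right (by omega) (by omega)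

/-- The degeneracy of a graph without `K_{t,t}` and without a given induced forest is bounded by
a polynomial in `t`. -/
theorem IsAcyclic.degeneracy_le [Finite V] [Finite W] (hH : H.IsAcyclic)
    (hHG : ¬ H.IsIndContained G) {t : ℕ} (ht : 1 ≤ t)
    (hG : (completeBipartiteGraph (Fin t) (Fin t)).Free G) {b : ℕ}
    (hb : 2 * Nat.card V * t ≤ b) : G.degeneracy ≤ b ^ (24 * Nat.card V) := by
  classical
  have := Fintype.ofFinite V
  have := Fintype.ofFinite W
  have hV : 1 ≤ Nat.card V := by
    by_contra! h0
    have : IsEmpty V := Finite.card_eq_zero_iff.1 (by omega)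
    exact hHG IsIndContained.of_isEmpty
  refine Nat.sInf_le ?_
  by_contra hdeg
  change ¬ G.IsDegenerate _ at hdeg
  rw [IsDegenerate] at hdeg
  push Not at hdeg
  obtain ⟨S, hS, hdeg⟩ := hdeg
  have : Nonempty S.verts := hS.to_subtype
  -- Passing from `S` to the induced subgraph on its vertices does not lower degrees and keeps
  -- copies of `H` induced in `G`.
  have hsub : (G.induce S.verts).IsIndContained G := ⟨Embedding.induce _⟩
  refine hHG (IsIndContained.trans (hH.isIndContained_of_le_minDegree ht
    (fun h => hG (h.trans hsub.isContained)) (d := b ^ (24 * Nat.card V)) (fun v => ?_) ?_) hsub)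
  · refine (hdeg v v.2).le.trans ?_
    rw [← Set.ncard_coe_finset, ← Set.ncard_image_of_injective _ Subtype.val_injective]
    refine Set.ncard_le_ncard (fun y hy => ?_) (Set.toFinite _)
    exact ⟨⟨y, S.edge_vert (show S.Adj v y from hy).symm⟩, by simpa using S.adj_sub hy, rfl⟩
  · rw [← Nat.card_eq_fintype_card]
    exact two_mul_pow_le_pow hV ht hb

theorem free_completeBipartiteGraph_of_bicliqueNumber_lt [Finite W] {t : ℕ}
    (ht : G.bicliqueNumber < t) : (completeBipartiteGraph (Fin t) (Fin t)).Free G :=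
  fun h => ht.not_ge (G.isGreatest_bicliqueNumber.2 h)

theorem degeneracy_eq_zero_of_bicliqueNumber_eq_zero [Finite W] (h : G.bicliqueNumber = 0) :
    G.degeneracy = 0 := by
  have hfree := free_completeBipartiteGraph_of_bicliqueNumber_lt (G := G) (t := 1) (by omega)
  refine Nat.eq_zero_of_le_zero (Nat.sInf_le ?_)
  rintro S ⟨x, hx⟩
  refine ⟨x, hx, ?_⟩
  rw [Nat.le_zero, Set.ncard_eq_zero (Set.toFinite _), Set.eq_empty_iff_forall_notMem]
  intro y hy
  have := Fintype.ofFinite W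
  exact hfree (isContained_completeBipartiteGraph_of_forall_adj (A := {x}) (B := {y})
    (by simp) (by simp) (by simpa using S.adj_sub hy))

end Embedding

end SimpleGraph

/-! ### Choice of parameters for the two bounds -/

theorem theorem2p5 {V : Type u} [Finite V] (H : SimpleGraph V) :
    (H.IsAcyclic →
      ∃ c : ℕ, 0 < c ∧
        ∀ (W : Type v) [Finite W] (G : SimpleGraph W), ¬ H.IsIndContained G →
          (G.bicliqueNumber ≠ 1 → G.degeneracy ≤ G.bicliqueNumber ^ c) ∧
          (G.bicliqueNumber = 1 → G.degeneracy ≤ c)) ∧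
    (H.IsTree →
      ∀ (r : V) (η t ζ : ℕ), 1 ≤ η → 1 ≤ t → 2 ≤ ζ →
        H.rootedHeight r ≤ η → H.spread r ≤ ζ →
        ∀ (W : Type v) [Finite W] (G : SimpleGraph W), ¬ H.IsIndContained G →
          (completeBipartiteGraph (Fin t) (Fin t)).Free G →
          G.degeneracy ≤
            (Nat.card V * ζ * t) ^ (Nat.factorial (η + 3) * Nat.card V)) := by
  refine ⟨fun hH => ?_, fun hH r η t ζ hη ht hζ _ _ W _ G hHG hG => ?_⟩
  · refine ⟨(2 * Nat.card V + 2) * (24 * Nat.card V) + (4 * Nat.card V) ^ (24 * Nat.card V) + 1,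
      Nat.succ_pos _, fun W _ G hHG => ⟨fun h1 => ?_, fun h1 => ?_⟩⟩
    · rcases Nat.eq_zero_or_pos G.bicliqueNumber with h0 | hpos
      · rw [G.degeneracy_eq_zero_of_bicliqueNumber_eq_zero h0]
        exact Nat.zero_le _
      have h2 : 2 ≤ G.bicliqueNumber := by omega
      -- Absorbing the constants into a power of `τ` needs `τ ≥ 2`: then `2n ≤ τ^(2n)` and `τ + 1 ≤
      -- τ^2`.
      have hb : 2 * Nat.card V * (G.bicliqueNumber + 1) ≤
          G.bicliqueNumber ^ (2 * Nat.card V + 2) := by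
        rw [pow_add]
        refine Nat.mul_le_mul ?_ (by nlinarith)
        exact (Nat.lt_two_pow_self).le.trans (Nat.pow_le_pow_left h2 _)
      refine (hH.degeneracy_le hHG (Nat.succ_pos _)
        (SimpleGraph.free_completeBipartiteGraph_of_bicliqueNumber_lt (Nat.lt_succ_self _))
        hb).trans ?_
      rw [← pow_mul]
      exact Nat.pow_le_pow_right hpos (by omega)
    · refine (hH.degeneracy_le hHG (t := 2) (by omega)
        (SimpleGraph.free_completeBipartiteGraph_of_bicliqueNumber_lt (by omega))
        (b := 4 * Nat.card V) (by omega)).trans (by omega)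
  · have hV : 0 < Nat.card V := Nat.card_pos_iff.2 ⟨⟨r⟩, inferInstance⟩
    refine (hH.isAcyclic.degeneracy_le hHG ht hG (b := Nat.card V * ζ * t) ?_).trans ?_
    -- The factor `2` in the required base is supplied by `ζ ≥ 2`.
    · rw [mul_comm 2]
      gcongr
    · refine Nat.pow_le_pow_right (by positivity) (Nat.mul_le_mul_right _ ?_)
      exact Nat.factorial_le (show 4 ≤ η + 3 by omega)
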